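/- **Theorem.** Call a set $X$ *dually Dedekind finite* if every surjection from $X$ onto $X$ is injective, and *dually Dedekind infinite* otherwise. For $n\in\omega$ let $A_n$ be the set of all atoms $[s]_n$, where $s$ ranges over the nonempty finite strings of numbers $0,\dots,n$; distinct pairs $(n,s)$ give distinct atoms. Let $A=\bigcup_{n\in\omega}A_n$ (a disjoint union) be the set of all atoms, and for $i\leqslant n$ let $A_{n,i}=\{[i^\smallfrown s]_n\mid s\text{ is a finite string of numbers }0,\dots,n\}$. Define $f_n:\prod_{i\leqslant n}A_{n,i}\to\{\varnothing\}\cup\prod_{i\leqslant n}A_{n,i}$ by \[ \begin{aligned} f_n([0j_0]_n,\dots,[nj_n]_n)&=\varnothing,\\ f_n([0^\smallfrown s_0{}^\smallfrown k_0l_0]_n,\dots,[n^\smallfrown s_n{}^\smallfrown k_nl_n]_n)&=([0^\smallfrown s_0{}^\smallfrown m_0]_n,\dots,[n^\smallfrown s_n{}^\smallfrown m_n]_n), \end{aligned} \] where $s_0,\dots,s_n$ are (possibly empty) finite strings of the same length and $m_i\in\{0,\dots,n\}$, $m_i\equiv\sum_{j\neq i}k_j\pmod{n+1}$, and $f_n(x)=x$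 for all other $x$. Every permutation $\pi$ of $A$ extends to the universe of sets with atoms $A$ by $\pi x=\{\pi z\mid z\in x\}$. Let $\mathcal G$ be the group of all permutations $\pi$ of $A$ such that for every $n\in\omega$: (1) $\pi$ fixes $A_{n,i}$ setwise for all $i\leqslant n$; (2) if $\pi[s]_n=[t]_n$, then $s$ and $t$ have the same length; (3) $\pi f_n=f_n$. Let $\mathcal V$ be the permutation model determined by $\mathcal G$: $x\in\mathcal V$ if and only if all elements of $x$ are in $\mathcal V$ and there is a finite $E\subseteq A$ such that every $\pi\in\mathcal G$ fixing $E$ pointwise satisfies $\pi x=x$. Then in $\mathcal V$, for every $n\in\omega$, the set $A_n^n$ (all functions from $n=\{0,\dots,n-1\}$ to $A_n$) is dually Dedekind finite, and $A_n^{n+1}$ is dually Dedekind infinite. -/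

import Mathlib

universe u

/-! ### The universe of sets with atoms over a type `A` -/

/-- Codes for atoms and for sets over `A`: `mk ι F` codes the set `{F i | i : ι}`. -/
inductive PreZFA (A : Type) : Type (u + 1)
  | atom (a : A) : PreZFA A
  | mk (ι : Type u) (F : ι → PreZFA A) : PreZFA A

namespace PreZFA

variable {A : Type}

/-- Two codes denote the same object: the same atom, or sets with the same elements. -/
def Equiv : PreZFA.{u} A → PreZFA.{u} A → Prop
  | atom a, atom b => a = b
  | mk _ F, mk _ G => (∀ i, ∃ j, Equiv (F i) (G j)) ∧ (∀ j, ∃ i, Equiv (F i) (G j))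
  | atom _, mk _ _ => False
  | mk _ _, atom _ => False

theorem Equiv.refl : ∀ x : PreZFA.{u} A, Equiv x x
  | atom _ => by simp [Equiv]
  | mk _ F => by
    rw [Equiv]
    exact ⟨fun i => ⟨i, Equiv.refl (F i)⟩, fun i => ⟨i, Equiv.refl (F i)⟩⟩

theorem Equiv.symm : ∀ {x y : PreZFA.{u} A}, Equiv x y → Equiv y x
  | atom _, atom _, h => by simp only [Equiv] at h ⊢; exact h.symm
  | mk _ _, mk _ _, h => by
    rw [Equiv] at h ⊢
    exact ⟨fun j => (h.2 j).imp fun _ hi => Equiv.symm hi,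
      fun i => (h.1 i).imp fun _ hj => Equiv.symm hj⟩
  | atom _, mk _ _, h => by simp [Equiv] at h
  | mk _ _, atom _, h => by simp [Equiv] at h

theorem Equiv.trans : ∀ {x y z : PreZFA.{u} A}, Equiv x y → Equiv y z → Equiv x z
  | atom _, atom _, atom _, h, h' => by simp only [Equiv] at h h' ⊢; exact h.trans h'
  | mk _ _, mk _ _, mk _ _, h, h' => by
    rw [Equiv] at h h' ⊢
    refine ⟨fun i => ?_, fun k => ?_⟩
    · obtain ⟨j, hj⟩ := h.1 i
      obtain ⟨k, hk⟩ := h'.1 j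
      exact ⟨k, Equiv.trans hj hk⟩
    · obtain ⟨j, hj⟩ := h'.2 k
      obtain ⟨i, hi⟩ := h.2 j
      exact ⟨i, Equiv.trans hi hj⟩
  | atom _, mk _ _, _, h, _ => by simp [Equiv] at h
  | mk _ _, atom _, _, h, _ => by simp [Equiv] at h
  | atom _, atom _, mk _ _, _, h => by simp [Equiv] at h
  | mk _ _, mk _ _, atom _, _, h => by simp [Equiv] at h

instance setoid (A : Type) : Setoid (PreZFA.{u} A) :=
  ⟨Equiv, Equiv.refl, Equiv.symm, Equiv.trans⟩

/-- Membership; atoms have no elements. -/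
def Mem (x : PreZFA.{u} A) : PreZFA.{u} A → Prop
  | atom _ => False
  | mk _ F => ∃ i, Equiv x (F i)

theorem Mem.congr : ∀ {x x' y y' : PreZFA.{u} A}, Equiv x x' → Equiv y y' →
    Mem x y → Mem x' y'
  | _, _, atom _, _, _, _, h => by simp [Mem] at h
  | _, _, mk _ _, atom _, _, h, _ => by simp [Equiv] at h
  | _, _, mk _ _, mk _ _, hx, hy, h => by
    simp only [Mem] at h ⊢
    rw [Equiv] at hy
    obtain ⟨i, hi⟩ := h
    obtain ⟨j, hj⟩ := hy.1 i
    exact ⟨j, (hx.symm.trans hi).trans hj⟩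

def IsAtom : PreZFA.{u} A → Prop
  | atom _ => True
  | mk _ _ => False

theorem IsAtom.congr : ∀ {x y : PreZFA.{u} A}, Equiv x y → IsAtom x → IsAtom y
  | _, atom _, _, _ => trivial
  | atom _, mk _ _, h, _ => by simp [Equiv] at h
  | mk _ _, mk _ _, _, h => h

/-- The extension of a permutation `π` of the atoms, `π x = {π z | z ∈ x}`. -/
def act (π : Equiv.Perm A) : PreZFA.{u} A → PreZFA.{u} A
  | atom a => atom (π a)
  | mk ι F => mk ι (fun i => act π (F i))

theorem act_congr (π : Equiv.Perm A) : ∀ {x y : PreZFA.{u} A}, Equiv x y →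
    Equiv (act π x) (act π y)
  | atom _, atom _, h => by simp only [Equiv, act] at h ⊢; rw [h]
  | mk _ _, mk _ _, h => by
    rw [Equiv] at h
    simp only [act]
    rw [Equiv]
    exact ⟨fun i => (h.1 i).imp fun _ hj => act_congr π hj,
      fun j => (h.2 j).imp fun _ hi => act_congr π hi⟩
  | atom _, mk _ _, h => by simp [Equiv] at h
  | mk _ _, atom _, h => by simp [Equiv] at h

end PreZFA

/-- The universe of sets with atoms, the set of atoms being (a copy of) `A`. -/
def ZFAUniverse (A : Type) : Type (u + 1) := Quotient (PreZFA.setoid.{u} A)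

namespace ZFAUniverse

variable {A : Type}

/-- The atom `a` as an object of the universe. -/
def atom (a : A) : ZFAUniverse.{u} A := Quotient.mk _ (PreZFA.atom a)

/-- `Mem x y` is `x ∈ y`. -/
def Mem (x y : ZFAUniverse.{u} A) : Prop :=
  Quotient.liftOn₂ x y PreZFA.Mem fun _ _ _ _ hx hy =>
    propext ⟨PreZFA.Mem.congr hx hy,
      PreZFA.Mem.congr (PreZFA.Equiv.symm hx) (PreZFA.Equiv.symm hy)⟩

instance : Membership (ZFAUniverse.{u} A) (ZFAUniverse.{u} A) := ⟨fun y x => Mem x y⟩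

def IsAtom (x : ZFAUniverse.{u} A) : Prop :=
  Quotient.liftOn x PreZFA.IsAtom fun _ _ h =>
    propext ⟨PreZFA.IsAtom.congr h, PreZFA.IsAtom.congr (PreZFA.Equiv.symm h)⟩

/-- The action of a permutation of the atoms on the universe. -/
def act (π : Equiv.Perm A) (x : ZFAUniverse.{u} A) : ZFAUniverse.{u} A :=
  Quotient.map (PreZFA.act π) (fun _ _ h => PreZFA.act_congr π h) x

/-- The set whose elements are the atoms in `S`. -/
def atomSet (S : Set A) : ZFAUniverse.{u} A :=
  Quotient.mk _ (PreZFA.mk (ULift.{u} S) fun a => PreZFA.atom a.down.1)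

theorem mem_atomSet {S : Set A} {x : ZFAUniverse.{u} A} :
    x ∈ atomSet S ↔ ∃ a ∈ S, x = atom a := by
  induction x using Quotient.inductionOn with
  | h x =>
    constructor
    · rintro ⟨⟨⟨a, ha⟩⟩, h⟩
      exact ⟨a, ha, Quotient.sound h⟩
    · rintro ⟨a, ha, h⟩
      exact ⟨⟨⟨a, ha⟩⟩, Quotient.exact h⟩

theorem not_mem_atom {a : A} {x : ZFAUniverse.{u} A} : ¬ x ∈ atom a := by
  induction x using Quotient.inductionOn with
  | h x => exact fun h => h

theorem act_atom (π : Equiv.Perm A) (a : A) :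
    act π (atom a : ZFAUniverse.{u} A) = atom (π a) := rfl

theorem act_atomSet {π : Equiv.Perm A} {S : Set A} (h : π '' S = S) :
    act π (atomSet S : ZFAUniverse.{u} A) = atomSet S := by
  refine Quotient.sound ?_
  change PreZFA.Equiv (PreZFA.mk _ fun a : ULift.{u} S => PreZFA.atom (π a.down.1))
    (PreZFA.mk _ fun a : ULift.{u} S => PreZFA.atom a.down.1)
  rw [PreZFA.Equiv]
  constructor
  · rintro ⟨a, ha⟩
    exact ⟨⟨⟨π a, h ▸ Set.mem_image_of_mem π ha⟩⟩, PreZFA.Equiv.refl _⟩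
  · rintro ⟨b, hb⟩
    have hb' := hb
    rw [← h] at hb'
    obtain ⟨a, ha, rfl⟩ := hb'
    exact ⟨⟨⟨a, ha⟩⟩, PreZFA.Equiv.refl _⟩

/-- `E` is a support of `x` with respect to the group `G`: every permutation in `G` that fixes
`E` pointwise fixes `x`. -/
def IsSupport (G : Subgroup (Equiv.Perm A)) (E : Set A) (x : ZFAUniverse.{u} A) : Prop :=
  ∀ π ∈ G, (∀ a ∈ E, π a = a) → act π x = x

/-- The permutation model determined by `G` (and finite supports), as a class:
`x` belongs to it iff all elements of `x` do and `x` has a finite support. -/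
inductive InPermModel (G : Subgroup (Equiv.Perm A)) : ZFAUniverse.{u} A → Prop
  | intro (x : ZFAUniverse.{u} A) (helem : ∀ y, y ∈ x → InPermModel G y)
      (hsupp : ∃ E : Set A, E.Finite ∧ IsSupport G E x) : InPermModel G x

end ZFAUniverse

/-! ### Set-theoretic notions inside a structure with atoms

All quantifiers below range over the structure `M`, so for a permutation model `M` these are the
notions as computed in `M`. -/

/-- A structure for the language of set theory with atoms. -/
class SetAtomStructure (M : Type*) extends Membership M M where
  IsAtom : M → Prop

namespace SetAtomStructure

variable {M : Type*} [SetAtomStructure M]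

/-- `x` is the set `{z | φ z}`. -/
def IsSetOf (x : M) (φ : M → Prop) : Prop := ¬ IsAtom x ∧ ∀ z, z ∈ x ↔ φ z

/-- `p = {a, b}`. -/
def IsPair (p a b : M) : Prop := IsSetOf p fun z => z = a ∨ z = b

/-- `p = (a, b) = {{a}, {a, b}}`. -/
def IsOrdPair (p a b : M) : Prop := ∃ s t, IsPair s a a ∧ IsPair t a b ∧ IsPair p s t

/-- `(x, y) ∈ f`. -/
def Maps (f x y : M) : Prop := ∃ p, p ∈ f ∧ IsOrdPair p x y

/-- `f` is a function from `X` to `Y`. -/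
def IsFunction (f X Y : M) : Prop :=
  ¬ IsAtom f ∧ (∀ p, p ∈ f → ∃ x y, x ∈ X ∧ y ∈ Y ∧ IsOrdPair p x y) ∧
    ∀ x, x ∈ X → ∃! y, Maps f x y

/-- `f` is a surjection from `X` onto `Y`. -/
def IsSurjection (f X Y : M) : Prop :=
  IsFunction f X Y ∧ ∀ y, y ∈ Y → ∃ x, x ∈ X ∧ Maps f x y

/-- The function `f` is injective. -/
def IsInjective (f : M) : Prop := ∀ x x' y, Maps f x y → Maps f x' y → x = x'

/-- Every surjection from `X` onto `X` is injective. -/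
def DuallyDedekindFinite (X : M) : Prop := ∀ g, IsSurjection g X X → IsInjective g

def DuallyDedekindInfinite (X : M) : Prop := ¬ DuallyDedekindFinite X

/-- `x` is the natural number `k = {0, …, k - 1}`. -/
def IsNumeral : ℕ → M → Prop
  | 0, x => IsSetOf x fun _ => False
  | k + 1, x => ∃ y, IsNumeral k y ∧ IsSetOf x fun z => z ∈ y ∨ z = y

/-- `Y = X ^ k`, the set of all functions from `k = {0, …, k - 1}` to `X`. -/
def IsPower (Y X : M) (k : ℕ) : Prop :=
  ∃ N, IsNumeral k N ∧ IsSetOf Y fun f => IsFunction f N X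

end SetAtomStructure

/-- The permutation model determined by a group of permutations of the atoms. -/
def PermModel {A : Type} (G : Subgroup (Equiv.Perm A)) : Type (u + 1) :=
  {x : ZFAUniverse.{u} A // ZFAUniverse.InPermModel G x}

instance {A : Type} (G : Subgroup (Equiv.Perm A)) : SetAtomStructure (PermModel.{u} G) where
  mem y x := x.1 ∈ y.1
  IsAtom x := ZFAUniverse.IsAtom x.1

/-! ### The atoms, the maps `f_n` and the group -/

/-- The atoms: `⟨n, s⟩` is `[s]_n`, for `s` a nonempty finite string of numbers `0, …, n`. -/
abbrev StringAtom : Type := Σ n : ℕ, {s : List (Fin (n + 1)) // s ≠ []}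

namespace StringAtom

/-- `A_n`. -/
def level (n : ℕ) : Set StringAtom := {a | ∃ s, a = ⟨n, s⟩}

/-- The atom `[i⌢s]_n`. -/
def cons (n : ℕ) (i : Fin (n + 1)) (s : List (Fin (n + 1))) : StringAtom :=
  ⟨n, i :: s, List.cons_ne_nil i s⟩

/-- `A_{n,i}`. -/
def cell (n : ℕ) (i : Fin (n + 1)) : Set StringAtom := {a | ∃ s, a = cons n i s}

/-- The tuple `x` has the form `([0 j_0]_n, …, [n j_n]_n)`. -/
def IsShort {n : ℕ} (x : Fin (n + 1) → StringAtom) (j : Fin (n + 1) → Fin (n + 1)) : Prop :=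
  ∀ i, x i = cons n i [j i]

/-- The tuple `x` has the form `([0⌢s_0⌢k_0 l_0]_n, …, [n⌢s_n⌢k_n l_n]_n)` with `s_0, …, s_n` of
the same length. -/
def IsLong {n : ℕ} (x : Fin (n + 1) → StringAtom) (s : Fin (n + 1) → List (Fin (n + 1)))
    (k l : Fin (n + 1) → Fin (n + 1)) : Prop :=
  (∀ i i', (s i).length = (s i').length) ∧ ∀ i, x i = cons n i (s i ++ [k i, l i])

/-- The graph of `f_n : ∏_{i ≤ n} A_{n,i} → {∅} ∪ ∏_{i ≤ n} A_{n,i}`, with `none` for `∅`.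
Addition in `Fin (n + 1)` is addition modulo `n + 1`. -/
inductive FGraph (n : ℕ) :
    (Fin (n + 1) → StringAtom) → Option (Fin (n + 1) → StringAtom) → Prop
  | short (x) (j) (hx : IsShort x j) : FGraph n x none
  | long (x) (s) (k) (l) (hx : IsLong x s k l) :
      FGraph n x (some fun i => cons n i (s i ++ [∑ j ∈ Finset.univ.erase i, k j]))
  | other (x) (hx : ∀ i, x i ∈ cell n i) (hshort : ∀ j, ¬ IsShort x j)
      (hlong : ∀ s k l, ¬ IsLong x s k l) : FGraph n x (some x)

/-- The three conditions on a permutation `π` of the atoms: it fixes every `A_{n,i}` setwise, it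
preserves the lengths of strings, and `π f_n = f_n`, that is, `π` maps the graph of `f_n` onto
itself (`π` acts on tuples coordinatewise and fixes `∅`). -/
def IsAdmissible (π : Equiv.Perm StringAtom) : Prop :=
  (∀ n i, π '' cell n i = cell n i) ∧
  (∀ n s t, π ⟨n, s⟩ = ⟨n, t⟩ → s.1.length = t.1.length) ∧
  (∀ n x y, FGraph n x y ↔ FGraph n (fun i => π (x i)) (y.map fun z i => π (z i)))

theorem level_eq (n : ℕ) : level n = ⋃ i, cell n i := by
  ext a
  simp only [level, cell, Set.mem_ofPred_eq, Set.mem_iUnion]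
  constructor
  · rintro ⟨⟨s, hs⟩, rfl⟩
    cases s with
    | nil => exact absurd rfl hs
    | cons i s => exact ⟨i, s, rfl⟩
  · rintro ⟨i, s, rfl⟩
    exact ⟨_, rfl⟩

theorem IsAdmissible.image_level {π : Equiv.Perm StringAtom} (h : IsAdmissible π) (n : ℕ) :
    π '' level n = level n := by
  rw [level_eq, Set.image_iUnion]
  exact Set.iUnion_congr fun i => h.1 n i

theorem IsAdmissible.mul {π ρ : Equiv.Perm StringAtom} (hπ : IsAdmissible π)
    (hρ : IsAdmissible ρ) : IsAdmissible (π * ρ) := by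
  refine ⟨fun n i => ?_, fun n s t h => ?_, fun n x y => ?_⟩
  · rw [Equiv.Perm.coe_mul, Set.image_comp, hρ.1, hπ.1]
  · have h1 : ρ ⟨n, s⟩ ∈ level n := by
      rw [← hρ.image_level n]
      exact ⟨_, ⟨s, rfl⟩, rfl⟩
    obtain ⟨r, hr⟩ := h1
    rw [Equiv.Perm.mul_apply, hr] at h
    exact (hρ.2.1 n s r hr).trans (hπ.2.1 n r t h)
  · rw [hρ.2.2, hπ.2.2, Option.map_map]
    rfl

theorem IsAdmissible.inv {π : Equiv.Perm StringAtom} (hπ : IsAdmissible π) :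
    IsAdmissible π⁻¹ := by
  refine ⟨fun n i => ?_, fun n s t h => ?_, fun n x y => ?_⟩
  · conv_lhs => rw [← hπ.1 n i]
    rw [← Set.image_comp]
    convert Set.image_id _
    exact funext fun a => by simp
  · rw [Equiv.Perm.inv_eq_iff_eq] at h
    exact (hπ.2.1 n t s h.symm).symm
  · rw [hπ.2.2 n (fun i => π⁻¹ (x i))]
    rw [Option.map_map]
    have : ((fun (z : Fin (n + 1) → StringAtom) i => π (z i)) ∘ fun z i => π⁻¹ (z i)) = id := by
      ext z : 1
      simp
    rw [this]
    simp

/-- The group of all admissible permutations of the atoms. -/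
def group : Subgroup (Equiv.Perm StringAtom) where
  carrier := {π | IsAdmissible π}
  mul_mem' h h' := h.mul h'
  one_mem' := by
    refine ⟨fun n i => by simp, fun n s t h => ?_, fun n x y => by simp⟩
    obtain rfl := eq_of_heq (Sigma.mk.inj h).2
    rfl
  inv_mem' h := h.inv

theorem atom_inPermModel (a : StringAtom) :
    ZFAUniverse.InPermModel group (ZFAUniverse.atom.{u} a) := by
  refine ⟨_, fun y hy => absurd hy ZFAUniverse.not_mem_atom, {a}, Set.finite_singleton a, ?_⟩
  intro π _ h
  rw [ZFAUniverse.act_atom, h a rfl]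

theorem level_inPermModel (n : ℕ) :
    ZFAUniverse.InPermModel group (ZFAUniverse.atomSet.{u} (level n)) := by
  refine ⟨_, fun y hy => ?_, ∅, Set.finite_empty, fun π hπ _ => ?_⟩
  · obtain ⟨a, _, rfl⟩ := ZFAUniverse.mem_atomSet.1 hy
    exact atom_inPermModel a
  · exact ZFAUniverse.act_atomSet (IsAdmissible.image_level hπ n)

end StringAtom

/-- The permutation model `𝒱`. -/
abbrev StringModel : Type (u + 1) := PermModel.{u} StringAtom.group

/-- The set `A_n` of atoms, as an element of `𝒱`. -/
def StringModel.A (n : ℕ) : StringModel.{u} :=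
  ⟨ZFAUniverse.atomSet (StringAtom.level n), StringAtom.level_inPermModel n⟩

namespace ZFAUniverse

/-! ### Extensionality and the action of permutations -/

variable {A : Type}

theorem ext {x y : ZFAUniverse.{u} A} (hx : ¬ IsAtom x) (hy : ¬ IsAtom y)
    (h : ∀ z, z ∈ x ↔ z ∈ y) : x = y := by
  induction x, y using Quotient.inductionOn₂ with
  | h x y =>
    match x, y, hx, hy, h with
    | .atom _, _, hx, _, _ => exact absurd trivial hx
    | _, .atom _, _, hy, _ => exact absurd trivial hy
    | .mk ι F, .mk κ G, _, _, h =>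
      refine Quotient.sound ?_
      change PreZFA.Equiv _ _
      rw [PreZFA.Equiv]
      constructor
      · intro i
        exact (h (Quotient.mk _ (F i))).1 ⟨i, PreZFA.Equiv.refl _⟩
      · intro j
        obtain ⟨i, hi⟩ := (h (Quotient.mk _ (G j))).2 ⟨j, PreZFA.Equiv.refl _⟩
        exact ⟨i, hi.symm⟩

theorem atom_injective : Function.Injective (atom : A → ZFAUniverse.{u} A) := by
  intro a b h
  have h' : PreZFA.Equiv (PreZFA.atom.{u} a) (PreZFA.atom b) := Quotient.exact h
  simpa [PreZFA.Equiv] using h'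

/-- The set `{F i | i : ι}`. -/
noncomputable def ofFam {ι : Type} (F : ι → ZFAUniverse.{u} A) : ZFAUniverse.{u} A :=
  Quotient.mk _ (PreZFA.mk (ULift.{u} ι) fun i => (F i.down).out)

theorem not_isAtom_ofFam {ι : Type} (F : ι → ZFAUniverse.{u} A) : ¬ IsAtom (ofFam F) := id

theorem mem_ofFam {ι : Type} {F : ι → ZFAUniverse.{u} A} {z : ZFAUniverse.{u} A} :
    z ∈ ofFam F ↔ ∃ i, z = F i := by
  induction z using Quotient.inductionOn with
  | h z =>
    constructor
    · rintro ⟨⟨i⟩, h⟩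
      refine ⟨i, ?_⟩
      rw [← Quotient.out_eq (F i)]
      exact Quotient.sound h
    · rintro ⟨i, h⟩
      rw [← Quotient.out_eq (F i)] at h
      exact ⟨⟨i⟩, Quotient.exact h⟩

theorem isAtom_act {π : Equiv.Perm A} {x : ZFAUniverse.{u} A} : IsAtom (act π x) ↔ IsAtom x := by
  induction x using Quotient.inductionOn with
  | h x => cases x <;> exact Iff.rfl

theorem mem_act {π : Equiv.Perm A} {x z : ZFAUniverse.{u} A} :
    z ∈ act π x ↔ ∃ y, y ∈ x ∧ z = act π y := by
  induction x, z using Quotient.inductionOn₂ with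
  | h x z =>
    cases x with
    | atom a => exact ⟨False.elim, fun ⟨y, hy, _⟩ => not_mem_atom hy⟩
    | mk ι F =>
      constructor
      · rintro ⟨i, h⟩
        exact ⟨Quotient.mk _ (F i), ⟨i, PreZFA.Equiv.refl _⟩, Quotient.sound h⟩
      · rintro ⟨y, hy, h⟩
        induction y using Quotient.inductionOn with
        | h y =>
          obtain ⟨i, hi⟩ := hy
          exact ⟨i, (Quotient.exact h).trans (PreZFA.act_congr π hi)⟩

theorem act_ofFam (π : Equiv.Perm A) {ι : Type} (F : ι → ZFAUniverse.{u} A) :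
    act π (ofFam F) = ofFam fun i => act π (F i) := by
  refine ext (fun h => not_isAtom_ofFam F (isAtom_act.1 h)) (not_isAtom_ofFam _) fun z => ?_
  rw [mem_act, mem_ofFam]
  constructor
  · rintro ⟨y, hy, rfl⟩
    obtain ⟨i, rfl⟩ := mem_ofFam.1 hy
    exact ⟨i, rfl⟩
  · rintro ⟨i, rfl⟩
    exact ⟨F i, mem_ofFam.2 ⟨i, rfl⟩, rfl⟩

/-- Reindexing along a bijection does not change the coded set. -/
theorem ofFam_comp_equiv {ι κ : Type} (e : ι ≃ κ) (F : κ → ZFAUniverse.{u} A) :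
    ofFam (fun i => F (e i)) = ofFam F := by
  refine ext (not_isAtom_ofFam _) (not_isAtom_ofFam _) fun z => ?_
  rw [mem_ofFam, mem_ofFam, e.surjective.exists]

/-! ### Ordered pairs -/

/-- The unordered pair `{x, y}`. -/
noncomputable def pair (x y : ZFAUniverse.{u} A) : ZFAUniverse.{u} A :=
  ofFam fun b : Bool => cond b x y

theorem mem_pair {x y z : ZFAUniverse.{u} A} : z ∈ pair x y ↔ z = x ∨ z = y := by
  rw [pair, mem_ofFam]
  simp [or_comm]

theorem act_pair (π : Equiv.Perm A) (x y : ZFAUniverse.{u} A) :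
    act π (pair x y) = pair (act π x) (act π y) := by
  rw [pair, act_ofFam, pair]
  congr 1
  ext b
  cases b <;> rfl

theorem pair_eq_pair {x y z w : ZFAUniverse.{u} A} (h : pair x y = pair z w) :
    (x = z ∧ y = w) ∨ (x = w ∧ y = z) := by
  have h1 : x = z ∨ x = w := mem_pair.1 (h ▸ mem_pair.2 (Or.inl rfl))
  have h2 : y = z ∨ y = w := mem_pair.1 (h ▸ mem_pair.2 (Or.inr rfl))
  have h3 : z = x ∨ z = y := mem_pair.1 (h ▸ mem_pair.2 (Or.inl rfl))
  have h4 : w = x ∨ w = y := mem_pair.1 (h ▸ mem_pair.2 (Or.inr rfl))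
  grind

/-- The ordered pair `(x, y)`. -/
noncomputable def opair (x y : ZFAUniverse.{u} A) : ZFAUniverse.{u} A :=
  pair (pair x x) (pair x y)

theorem opair_inj {x y z w : ZFAUniverse.{u} A} : opair x y = opair z w ↔ x = z ∧ y = w := by
  constructor
  · intro h
    rcases pair_eq_pair h with ⟨h1, h2⟩ | ⟨h1, h2⟩
    · rcases pair_eq_pair h1 with ⟨rfl, _⟩ | ⟨rfl, _⟩ <;>
        rcases pair_eq_pair h2 with ⟨_, rfl⟩ | ⟨rfl, rfl⟩ <;> exact ⟨rfl, rfl⟩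
    · rcases pair_eq_pair h1 with ⟨rfl, rfl⟩ | ⟨rfl, rfl⟩ <;>
        rcases pair_eq_pair h2 with ⟨_, rfl⟩ | ⟨_, rfl⟩ <;> exact ⟨rfl, rfl⟩
  · rintro ⟨rfl, rfl⟩
    rfl

theorem act_opair (π : Equiv.Perm A) (x y : ZFAUniverse.{u} A) :
    act π (opair x y) = opair (act π x) (act π y) := by
  simp only [opair, act_pair]

/-! ### Natural numbers -/

/-- The natural number `k = {0, …, k - 1}`. -/
noncomputable def num (k : ℕ) : ZFAUniverse.{u} A := ofFam fun i : Fin k => num i.1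
termination_by k
decreasing_by exact i.2

theorem not_isAtom_num (k : ℕ) : ¬ IsAtom (num k : ZFAUniverse.{u} A) := by
  rw [num]
  exact not_isAtom_ofFam _

theorem mem_num {k : ℕ} {z : ZFAUniverse.{u} A} : z ∈ num k ↔ ∃ i < k, z = num i := by
  rw [num, mem_ofFam]
  exact ⟨fun ⟨i, h⟩ => ⟨i, i.2, h⟩, fun ⟨i, hi, h⟩ => ⟨⟨i, hi⟩, h⟩⟩

/-- A numeral that is an element of itself equals a smaller numeral, which is then an element of
itself as well: descent. -/
theorem num_not_mem_self (k : ℕ) : ¬ (num k : ZFAUniverse.{u} A) ∈ num k := by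
  induction k using Nat.strong_induction_on with
  | _ k ih =>
    intro h
    obtain ⟨i, hi, h'⟩ := mem_num.1 h
    exact ih i hi (h' ▸ h)

theorem num_injective : Function.Injective (num : ℕ → ZFAUniverse.{u} A) := by
  intro i j h
  by_contra hij
  rcases Nat.lt_or_gt_of_ne hij with hlt | hlt
  · exact num_not_mem_self j (mem_num.2 ⟨i, hlt, h.symm⟩)
  · exact num_not_mem_self i (mem_num.2 ⟨j, hlt, h⟩)

theorem act_num (π : Equiv.Perm A) (k : ℕ) : act π (num k : ZFAUniverse.{u} A) = num k := by
  induction k using Nat.strong_induction_on with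
  | _ k ih =>
    rw [num, act_ofFam]
    congr 1
    ext i
    exact ih i.1 i.2

/-! ### Finite sequences of atoms -/

/-- The function from `k` to the atoms with values `x 0, …, x (k - 1)`. -/
noncomputable def tuple {k : ℕ} (x : Fin k → A) : ZFAUniverse.{u} A :=
  ofFam fun i => opair (num i.1) (atom (x i))

theorem tuple_injective {k : ℕ} :
    Function.Injective (tuple : (Fin k → A) → ZFAUniverse.{u} A) := by
  intro x y h
  ext i
  have hi : opair (num i.1) (atom (x i)) ∈ tuple.{u} y := h ▸ mem_ofFam.2 ⟨i, rfl⟩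
  obtain ⟨j, hj⟩ := mem_ofFam.1 hi
  obtain ⟨h1, h2⟩ := opair_inj.1 hj
  rw [atom_injective h2, Fin.ext (num_injective h1)]

theorem act_tuple (π : Equiv.Perm A) {k : ℕ} (x : Fin k → A) :
    act π (tuple x : ZFAUniverse.{u} A) = tuple fun i => π (x i) := by
  simp only [tuple, act_ofFam, act_opair, act_num, act_atom]

/-! ### Closure properties of permutation models -/

variable {G : Subgroup (Equiv.Perm A)}

theorem InPermModel.mem {x y : ZFAUniverse.{u} A} (hx : InPermModel G x) (hy : y ∈ x) :
    InPermModel G y := by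
  cases hx with
  | intro _ h _ => exact h y hy

theorem InPermModel.exists_support {x : ZFAUniverse.{u} A} (hx : InPermModel G x) :
    ∃ E : Set A, E.Finite ∧ IsSupport G E x := by
  cases hx with
  | intro _ _ h => exact h

theorem inPermModel_ofFam {ι : Type} {F : ι → ZFAUniverse.{u} A}
    (hF : ∀ i, InPermModel G (F i)) (h : ∃ E : Set A, E.Finite ∧ IsSupport G E (ofFam F)) :
    InPermModel G (ofFam F) := by
  refine ⟨_, fun y hy => ?_, h⟩
  obtain ⟨i, rfl⟩ := mem_ofFam.1 hy
  exact hF i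

theorem inPermModel_ofFam_of_finite {ι : Type} [Finite ι] {F : ι → ZFAUniverse.{u} A}
    (hF : ∀ i, InPermModel G (F i)) : InPermModel G (ofFam F) := by
  choose E hE hs using fun i => (hF i).exists_support
  refine inPermModel_ofFam hF ⟨⋃ i, E i, Set.finite_iUnion hE, fun π hπ h => ?_⟩
  rw [act_ofFam]
  congr 1
  ext i
  exact hs i π hπ fun a ha => h a (Set.mem_iUnion_of_mem i ha)

theorem InPermModel.pair {x y : ZFAUniverse.{u} A} (hx : InPermModel G x)
    (hy : InPermModel G y) : InPermModel G (pair x y) :=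
  inPermModel_ofFam_of_finite fun b => by cases b <;> assumption

theorem InPermModel.opair {x y : ZFAUniverse.{u} A} (hx : InPermModel G x)
    (hy : InPermModel G y) : InPermModel G (opair x y) :=
  (hx.pair hx).pair (hx.pair hy)

theorem inPermModel_num (k : ℕ) : InPermModel G (num k : ZFAUniverse.{u} A) := by
  induction k using Nat.strong_induction_on with
  | _ k ih =>
    rw [num]
    exact inPermModel_ofFam_of_finite fun i => ih i.1 i.2

theorem inPermModel_atom (a : A) : InPermModel G (atom a : ZFAUniverse.{u} A) :=
  ⟨_, fun _ hy => absurd hy not_mem_atom, {a}, Set.finite_singleton a,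
    fun π _ h => by rw [act_atom, h a rfl]⟩

theorem inPermModel_tuple {k : ℕ} (x : Fin k → A) :
    InPermModel G (tuple x : ZFAUniverse.{u} A) :=
  inPermModel_ofFam_of_finite fun i => (inPermModel_num i.1).opair (inPermModel_atom (x i))

end ZFAUniverse

/-! ### Absoluteness of the set-theoretic notions -/

namespace PermModel

open ZFAUniverse SetAtomStructure

variable {A : Type} {G : Subgroup (Equiv.Perm A)}

/-- The object of the universe that an element of the model is. -/
def val (x : PermModel.{u} G) : ZFAUniverse.{u} A := Subtype.val x

def mk (x : ZFAUniverse.{u} A) (hx : InPermModel G x) : PermModel.{u} G := ⟨x, hx⟩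

theorem val_mk (x : ZFAUniverse.{u} A) (hx : InPermModel G x) : (mk x hx).val = x := rfl

theorem val_injective : Function.Injective (val : PermModel.{u} G → ZFAUniverse.{u} A) :=
  fun _ _ h => Subtype.ext h

theorem val_inj {x y : PermModel.{u} G} : x.val = y.val ↔ x = y := val_injective.eq_iff

theorem inPermModel (x : PermModel.{u} G) : InPermModel G x.val := Subtype.property x

theorem mem_iff {x y : PermModel.{u} G} : x ∈ y ↔ x.val ∈ y.val := Iff.rfl

theorem isAtom_iff {x : PermModel.{u} G} :
    SetAtomStructure.IsAtom x ↔ ZFAUniverse.IsAtom x.val := Iff.rfl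

/-- The model is transitive, so extensionality in the universe identifies a set defined inside the
model. Pairs and numerals are computed through this. -/
theorem isSetOf_iff {x : PermModel.{u} G} {y : ZFAUniverse.{u} A} {φ : PermModel.{u} G → Prop}
    (hy : ¬ ZFAUniverse.IsAtom y)
    (h : ∀ z, z ∈ y ↔ ∃ hz : InPermModel G z, φ (mk z hz)) : IsSetOf x φ ↔ x.val = y := by
  constructor
  · rintro ⟨hx, hφ⟩
    refine ZFAUniverse.ext hx hy fun z => ?_
    rw [h]
    exact ⟨fun hz => ⟨x.inPermModel.mem hz, (hφ (mk z (x.inPermModel.mem hz))).1 hz⟩,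
      fun ⟨hz, hz'⟩ => (hφ (mk z hz)).2 hz'⟩
  · rintro rfl
    exact ⟨hy, fun z => (h z.val).trans ⟨fun ⟨_, hz⟩ => hz, fun hz => ⟨z.inPermModel, hz⟩⟩⟩

theorem isPair_iff {p x y : PermModel.{u} G} : IsPair p x y ↔ p.val = pair x.val y.val := by
  refine isSetOf_iff (not_isAtom_ofFam _) fun z => ?_
  rw [mem_pair]
  constructor
  · rintro (rfl | rfl)
    · exact ⟨x.inPermModel, Or.inl rfl⟩
    · exact ⟨y.inPermModel, Or.inr rfl⟩
  · rintro ⟨_, h | h⟩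
    · exact Or.inl (congrArg val h)
    · exact Or.inr (congrArg val h)

theorem isOrdPair_iff {p x y : PermModel.{u} G} : IsOrdPair p x y ↔ p.val = opair x.val y.val := by
  simp only [IsOrdPair, isPair_iff]
  constructor
  · rintro ⟨s, t, hs, ht, hp⟩
    rw [hp, hs, ht, opair]
  · intro hp
    exact ⟨mk _ (x.inPermModel.pair x.inPermModel), mk _ (x.inPermModel.pair y.inPermModel),
      rfl, rfl, hp⟩

theorem maps_iff {f x y : PermModel.{u} G} : Maps f x y ↔ opair x.val y.val ∈ f.val := by
  simp only [Maps, isOrdPair_iff]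
  exact ⟨fun ⟨p, hp, h⟩ => h ▸ hp, fun h => ⟨mk _ (x.inPermModel.opair y.inPermModel), h, rfl⟩⟩

theorem isNumeral_iff {k : ℕ} {x : PermModel.{u} G} : IsNumeral k x ↔ x.val = num k := by
  induction k generalizing x with
  | zero =>
    exact isSetOf_iff (not_isAtom_num 0) fun z => by simp [mem_num]
  | succ k ih =>
    have key : ∀ y : PermModel.{u} G, y.val = num k →
        (IsSetOf x (fun z => z ∈ y ∨ z = y) ↔ x.val = num (k + 1)) := fun y hy => by
      refine isSetOf_iff (not_isAtom_num _) fun z => ?_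
      have hz : z ∈ num (k + 1) ↔ z ∈ num k ∨ z = num k := by
        simp only [mem_num, Nat.lt_succ_iff_lt_or_eq]
        grind
      rw [hz, ← hy]
      constructor
      · rintro (h | rfl)
        · exact ⟨y.inPermModel.mem h, Or.inl h⟩
        · exact ⟨y.inPermModel, Or.inr rfl⟩
      · rintro ⟨_, h | h⟩
        · exact Or.inl h
        · exact Or.inr (congrArg val h)
    constructor
    · rintro ⟨y, hy, h⟩
      exact (key y (ih.1 hy)).1 h
    · intro h
      exact ⟨mk (num k) (inPermModel_num k), ih.2 rfl, (key _ rfl).2 h⟩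

theorem mem_of_maps_left {f x y X Y : PermModel.{u} G} (hf : IsFunction f X Y)
    (h : Maps f x y) : x ∈ X := by
  obtain ⟨p, hp, hxy⟩ := h
  obtain ⟨x', y', hx', -, h'⟩ := hf.2.1 p hp
  rw [isOrdPair_iff] at hxy h'
  rwa [val_injective (opair_inj.1 (hxy.symm.trans h')).1]

theorem mem_of_maps_right {f x y X Y : PermModel.{u} G} (hf : IsFunction f X Y)
    (h : Maps f x y) : y ∈ Y := by
  obtain ⟨p, hp, hxy⟩ := h
  obtain ⟨x', y', -, hy', h'⟩ := hf.2.1 p hp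
  rw [isOrdPair_iff] at hxy h'
  rwa [val_injective (opair_inj.1 (hxy.symm.trans h')).2]

/-- A finite sequence of atoms has a finite support, so the model contains all of them and the power
is the same inside and outside. -/
theorem isFunction_num_atomSet_iff {k : ℕ} {S : Set A} {f N Y : PermModel.{u} G}
    (hN : N.val = num k) (hY : Y.val = atomSet S) :
    IsFunction f N Y ↔ ∃ x : Fin k → S, f.val = tuple fun i => (x i).1 := by
  constructor
  · intro hf
    have hex : ∀ i : Fin k, ∃ a : S, opair (num i.1) (atom a.1) ∈ f.val := fun i => by
      obtain ⟨y, hy, -⟩ := hf.2.2 (mk (num i.1) (inPermModel_num i.1))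
        (by rw [mem_iff, hN]; exact mem_num.2 ⟨i, i.2, rfl⟩)
      have hyY := mem_of_maps_right hf hy
      rw [mem_iff, hY, mem_atomSet] at hyY
      obtain ⟨a, ha, hya⟩ := hyY
      exact ⟨⟨a, ha⟩, by rw [maps_iff, hya] at hy; exact hy⟩
    choose x hx using hex
    refine ⟨x, ZFAUniverse.ext hf.1 (not_isAtom_ofFam _) fun p => ?_⟩
    rw [tuple, mem_ofFam]
    constructor
    · intro hp
      obtain ⟨a, b, ha, hb, hab⟩ := hf.2.1 (mk p (f.inPermModel.mem hp)) hp
      have ha' := ha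
      rw [mem_iff, hN, mem_num] at ha'
      obtain ⟨i, hi, hai⟩ := ha'
      rw [isOrdPair_iff, val_mk] at hab
      refine ⟨⟨i, hi⟩, ?_⟩
      have h1 : Maps f a b := maps_iff.2 (hab ▸ hp)
      have h2 : Maps f a (mk (atom (x ⟨i, hi⟩).1) (inPermModel_atom _)) := by
        rw [maps_iff, hai]
        exact hx ⟨i, hi⟩
      rw [hab, hai, (hf.2.2 a ha).unique h1 h2, val_mk]
    · rintro ⟨i, rfl⟩
      exact hx i
  · rintro ⟨x, hx⟩
    refine ⟨fun h => not_isAtom_ofFam _ (hx ▸ isAtom_iff.1 h), fun p hp => ?_, fun a ha => ?_⟩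
    · rw [mem_iff, hx, tuple, mem_ofFam] at hp
      obtain ⟨i, hi⟩ := hp
      refine ⟨mk (num i.1) (inPermModel_num _), mk (atom (x i).1) (inPermModel_atom _), ?_, ?_,
        isOrdPair_iff.2 hi⟩
      · rw [mem_iff, hN]
        exact mem_num.2 ⟨i, i.2, rfl⟩
      · rw [mem_iff, hY]
        exact mem_atomSet.2 ⟨_, (x i).2, rfl⟩
    · rw [mem_iff, hN, mem_num] at ha
      obtain ⟨i, hi, hai⟩ := ha
      refine ⟨mk (atom (x ⟨i, hi⟩).1) (inPermModel_atom _), ?_, fun b hb => ?_⟩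
      · change Maps _ _ _
        rw [maps_iff, hai, hx]
        exact mem_ofFam.2 ⟨⟨i, hi⟩, rfl⟩
      · have hb' := maps_iff.1 hb
        rw [hai, hx] at hb'
        obtain ⟨j, hj⟩ := mem_ofFam.1 hb'
        obtain ⟨h1, h2⟩ := opair_inj.1 hj
        obtain rfl := num_injective h1
        exact val_injective h2

/-! ### Powers of a set of atoms and their self-maps in the model -/

/-- The permutation of `S ^ k` induced by a permutation that fixes `S` setwise. -/
def powerPerm {π : Equiv.Perm A} {S : Set A} (h : π '' S = S) (k : ℕ) :
    Equiv.Perm (Fin k → S) :=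
  Equiv.piCongrRight fun _ => π.subtypePerm fun a => by
    constructor
    · intro ha
      rw [← h] at ha
      obtain ⟨b, hb, hab⟩ := ha
      exact π.injective hab ▸ hb
    · intro ha
      rw [← h]
      exact ⟨a, ha, rfl⟩

theorem powerPerm_apply {π : Equiv.Perm A} {S : Set A} (h : π '' S = S) {k : ℕ}
    (x : Fin k → S) (i : Fin k) : (powerPerm h k x i).1 = π (x i).1 := rfl

/-- A family that is permuted by the group codes an element of the model. -/
theorem inPermModel_ofFam_of_perm {ι : Type} {F : ι → ZFAUniverse.{u} A}
    (hF : ∀ i, InPermModel G (F i))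
    (h : ∀ π ∈ G, ∃ e : Equiv.Perm ι, ∀ i, act π (F i) = F (e i)) :
    InPermModel G (ofFam F) := by
  refine inPermModel_ofFam hF ⟨∅, Set.finite_empty, fun π hπ _ => ?_⟩
  obtain ⟨e, he⟩ := h π hπ
  rw [act_ofFam]
  simp only [he]
  exact ofFam_comp_equiv e F

variable {S : Set A}

/-- The set of all functions from `k` to the set of the atoms in `S`. -/
noncomputable def power (hS : ∀ π ∈ G, π '' S = S) (k : ℕ) : PermModel.{u} G :=
  mk (ofFam fun x : Fin k → S => tuple fun i => (x i).1)
    (inPermModel_ofFam_of_perm (fun _ => inPermModel_tuple _) fun π hπ =>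
      ⟨powerPerm (hS π hπ) k, fun _ => act_tuple _ _⟩)

/-- A sequence of atoms in `S`, as an element of the model. -/
noncomputable def ofTuple (G : Subgroup (Equiv.Perm A)) {k : ℕ} (x : Fin k → S) :
    PermModel.{u} G :=
  mk (tuple fun i => (x i).1) (inPermModel_tuple _)

theorem ofTuple_injective {k : ℕ} :
    Function.Injective (ofTuple G : (Fin k → S) → PermModel.{u} G) := by
  intro x y h
  have := tuple_injective.{u} (show tuple (fun i => (x i).1) = tuple fun i => (y i).1 from congrArg val h)
  exact funext fun i => Subtype.ext (congrFun this i)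

theorem mem_power {hS : ∀ π ∈ G, π '' S = S} {k : ℕ} {f : PermModel.{u} G} :
    f ∈ power hS k ↔ ∃ x : Fin k → S, f = ofTuple G x := by
  simp only [mem_iff, power, val_mk, mem_ofFam, ← val_inj, ofTuple]

theorem not_isAtom_power (hS : ∀ π ∈ G, π '' S = S) (k : ℕ) :
    ¬ SetAtomStructure.IsAtom (power.{u} hS k) := by
  rw [isAtom_iff, power, val_mk]
  exact not_isAtom_ofFam _

theorem isPower_power (hS : ∀ π ∈ G, π '' S = S) (k : ℕ) {Y : PermModel.{u} G}
    (hY : Y.val = atomSet S) : IsPower (power hS k) Y k := by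
  refine ⟨mk (num k) (inPermModel_num k), isNumeral_iff.2 rfl,
    not_isAtom_power hS k, fun f => ?_⟩
  refine Iff.trans ?_ (isFunction_num_atomSet_iff rfl hY).symm
  rw [mem_iff, power, val_mk, mem_ofFam]

/-- An equivariant map from `S ^ k` to itself, as an element of the model. -/
noncomputable def ofEquivariant (hS : ∀ π ∈ G, π '' S = S) {k : ℕ}
    (F : (Fin k → S) → Fin k → S)
    (hF : ∀ π (hπ : π ∈ G) x, F (powerPerm (hS π hπ) k x) = powerPerm (hS π hπ) k (F x)) :
    PermModel.{u} G :=
  mk (ofFam fun x => opair (ofTuple.{u} G x).val (ofTuple G (F x)).val)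
    (inPermModel_ofFam_of_perm
      (fun x => (ofTuple G x).inPermModel.opair (ofTuple G (F x)).inPermModel)
      fun π hπ => ⟨powerPerm (hS π hπ) k, fun x => by
        rw [hF π hπ, act_opair]
        simp only [ofTuple, val_mk, act_tuple, powerPerm_apply]⟩)

theorem not_isAtom_ofEquivariant {hS : ∀ π ∈ G, π '' S = S} {k : ℕ}
    {F : (Fin k → S) → Fin k → S}
    {hF : ∀ π (hπ : π ∈ G) x, F (powerPerm (hS π hπ) k x) = powerPerm (hS π hπ) k (F x)} :
    ¬ SetAtomStructure.IsAtom (ofEquivariant.{u} hS F hF) := by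
  rw [isAtom_iff, ofEquivariant, val_mk]
  exact not_isAtom_ofFam _

theorem maps_ofEquivariant {hS : ∀ π ∈ G, π '' S = S} {k : ℕ} {F : (Fin k → S) → Fin k → S}
    {hF : ∀ π (hπ : π ∈ G) x, F (powerPerm (hS π hπ) k x) = powerPerm (hS π hπ) k (F x)}
    {x y : PermModel.{u} G} : Maps (ofEquivariant hS F hF) x y ↔
      ∃ z, x = ofTuple G z ∧ y = ofTuple G (F z) := by
  simp only [maps_iff, ofEquivariant, val_mk, mem_ofFam, opair_inj, val_inj]

/-- An equivariant map is invariant under the whole group, so its graph has empty support and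
witnesses the failure inside the model. -/
theorem duallyDedekindInfinite_power (hS : ∀ π ∈ G, π '' S = S) {k : ℕ}
    (F : (Fin k → S) → Fin k → S)
    (hF : ∀ π (hπ : π ∈ G) x, F (powerPerm (hS π hπ) k x) = powerPerm (hS π hπ) k (F x))
    (hsurj : Function.Surjective F) (hinj : ¬ Function.Injective F) :
    DuallyDedekindInfinite (power.{u} hS k) := by
  intro hfin
  refine hinj fun x x' h => ?_
  have hg : IsSurjection (ofEquivariant.{u} hS F hF) (power hS k) (power hS k) := by
    refine ⟨⟨not_isAtom_ofEquivariant, fun p hp => ?_, fun a ha => ?_⟩, fun b hb => ?_⟩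
    · rw [mem_iff, ofEquivariant, val_mk, mem_ofFam] at hp
      obtain ⟨z, hz⟩ := hp
      exact ⟨_, _, mem_power.2 ⟨z, rfl⟩, mem_power.2 ⟨F z, rfl⟩, isOrdPair_iff.2 hz⟩
    · obtain ⟨z, rfl⟩ := mem_power.1 ha
      refine ⟨ofTuple G (F z), maps_ofEquivariant.2 ⟨z, rfl, rfl⟩, fun b hb => ?_⟩
      obtain ⟨w, hw, rfl⟩ := maps_ofEquivariant.1 hb
      rw [ofTuple_injective hw]
    · obtain ⟨y, rfl⟩ := mem_power.1 hb
      obtain ⟨z, rfl⟩ := hsurj y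
      exact ⟨_, mem_power.2 ⟨z, rfl⟩, maps_ofEquivariant.2 ⟨z, rfl, rfl⟩⟩
  exact ofTuple_injective (hfin _ hg (ofTuple G x) (ofTuple G x') (ofTuple G (F x))
    (maps_ofEquivariant.2 ⟨x, rfl, rfl⟩) (maps_ofEquivariant.2 ⟨x', rfl, by rw [h]⟩))

/-- If every surjection from `S ^ k` onto itself that preserves stabilizers in the pointwise
stabilizer of a finite set is injective, then `S ^ k` is dually Dedekind finite in the model. -/
theorem duallyDedekindFinite_power (hS : ∀ π ∈ G, π '' S = S) {k : ℕ}
    (H : ∀ (E : Set A), E.Finite → ∀ h : (Fin k → S) → Fin k → S, Function.Surjective h →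
      (∀ π ∈ G, (∀ a ∈ E, π a = a) → ∀ x, (∀ i, π (x i).1 = (x i).1) →
        ∀ i, π (h x i).1 = (h x i).1) → Function.Injective h) :
    DuallyDedekindFinite (power.{u} hS k) := by
  rintro g ⟨hg, hsurj⟩
  have hex : ∀ x : Fin k → S, ∃ y : Fin k → S, Maps g (ofTuple G x) (ofTuple G y) := fun x => by
    obtain ⟨b, hb, -⟩ := hg.2.2 (ofTuple G x) (mem_power.2 ⟨x, rfl⟩)
    obtain ⟨y, rfl⟩ := mem_power.1 (mem_of_maps_right hg hb)
    exact ⟨y, hb⟩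
  choose h hh using hex
  have huniq : ∀ {x y}, Maps g (ofTuple G x) (ofTuple G y) → h x = y := fun {x y} hxy =>
    ofTuple_injective ((hg.2.2 _ (mem_power.2 ⟨x, rfl⟩)).unique (hh x) hxy)
  obtain ⟨E, hE, hsupp⟩ := g.inPermModel.exists_support
  have hinj : Function.Injective h := by
    refine H E hE h (fun y => ?_) fun π hπ hπE x hx => ?_
    · obtain ⟨a, ha, hay⟩ := hsurj (ofTuple G y) (mem_power.2 ⟨y, rfl⟩)
      obtain ⟨x, rfl⟩ := mem_power.1 ha
      exact ⟨x, huniq hay⟩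
    · have h1 := maps_iff.1 (hh x)
      -- Since π fixes g and x, it carries (x, h x) ∈ g to (x, π (h x)) ∈ g; single-valuedness of g
      -- gives π (h x) = h x.
      have h2 := mem_act (π := π).2 ⟨_, h1, rfl⟩
      rw [hsupp π hπ hπE, act_opair] at h2
      simp only [ofTuple, val_mk, act_tuple, hx] at h2
      have h3 : Maps g (ofTuple G x) (ofTuple G (powerPerm (hS π hπ) k (h x))) :=
        maps_iff.2 h2
      intro i
      exact (congrArg Subtype.val (congrFun (huniq h3) i)).symm
  intro a a' b ha ha'
  obtain ⟨x, rfl⟩ := mem_power.1 (mem_of_maps_left hg ha)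
  obtain ⟨x', rfl⟩ := mem_power.1 (mem_of_maps_left hg ha')
  obtain ⟨y, rfl⟩ := mem_power.1 (mem_of_maps_right hg ha)
  rw [hinj ((huniq ha).trans (huniq ha').symm)]

end PermModel

/-! ### A finiteness criterion for surjections -/

/-- A surjection that does not decrease an invariant is injective if the invariant has
finite fibres and there is no infinite strictly increasing sequence of values. -/
theorem Function.Surjective.injective_of_invariant_le {α β : Type*} [PartialOrder β] (S : α → β)
    {h : α → α} (hsurj : Function.Surjective h) (hle : ∀ x, S x ≤ S (h x))
    (hfib : ∀ b, {x | S x = b}.Finite) (hwf : WellFounded fun x y => S x < S y) :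
    Function.Injective h := by
  have key : ∀ x, {z | S z = S x} ⊆ h '' {z | S z = S x} ∧ S (h x) = S x := by
    intro x
    induction x using hwf.induction with
    | _ x ih =>
      have hsub : {z | S z = S x} ⊆ h '' {z | S z = S x} := by
        intro y hy
        obtain ⟨z, rfl⟩ := hsurj y
        refine ⟨z, ?_, rfl⟩
        -- A preimage z with strictly smaller value is excluded: by induction h would preserve its
        -- value.
        rcases (hle z).lt_or_eq with hlt | heq
        · have hy' : S (h z) = S x := hy
          exact absurd (ih z (hy' ▸ hlt)).2 hlt.ne'
        · exact heq.trans hy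
      refine ⟨hsub, ?_⟩
      -- A finite fibre contained in its own image equals it, so h maps the fibre onto itself.
      have heq := Set.eq_of_subset_of_ncard_le hsub (Set.ncard_image_le (hfib _))
        ((hfib _).image h)
      have : h x ∈ h '' {z | S z = S x} := ⟨x, rfl, rfl⟩
      rwa [← heq] at this
  intro x y hxy
  have hSxy : S x = S y := by rw [← (key x).2, ← (key y).2, hxy]
  have hcard : (h '' {z | S z = S x}).ncard = {z | S z = S x}.ncard :=
    le_antisymm (Set.ncard_image_le (hfib _))
      (Set.ncard_le_ncard (key x).1 ((hfib _).image h))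
  exact Set.injOn_of_ncard_image_eq hcard (hfib _) rfl hSxy.symm hxy

/-- Both ways to violate the criterion give an injective antitone sequence: an infinite fibre yields
a constant one, an infinite descent a strictly decreasing one. -/
theorem Function.Surjective.injective_of_no_monotone_seq {α β : Type*} [PartialOrder β]
    (S : α → β) {h : α → α} (hsurj : Function.Surjective h) (hle : ∀ x, S x ≤ S (h x))
    (hseq : ∀ x : ℕ → α, Function.Injective x → ¬ Antitone fun k => S (x k)) :
    Function.Injective h := by
  refine hsurj.injective_of_invariant_le S hle (fun b => ?_) ?_
  · by_contra hinf
    let e := Set.Infinite.natEmbedding _ hinf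
    refine hseq (fun k => (e k).1) (fun i j hij => e.injective (Subtype.ext hij)) ?_
    intro i j _
    exact (((e j).2 : S _ = b).trans ((e i).2 : S _ = b).symm).le
  · rw [wellFounded_iff_isEmpty_descending_chain]
    refine ⟨fun ⟨x, hx⟩ => ?_⟩
    have hs : StrictAnti fun k => S (x k) := strictAnti_nat_of_succ_lt hx
    exact hseq x (fun i j hij => hs.injective (congrArg S hij)) hs.antitone

/-! ### Shift permutations and their admissibility -/

theorem List.modify_append_of_lt_length {α : Type*} {f : α → α} {m : ℕ} {a : List α}
    (b : List α) (h : m < a.length) : (a ++ b).modify m f = a.modify m f ++ b := by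
  apply List.ext_getElem?
  intro i
  grind

theorem List.modify_append_of_length_le {α : Type*} {f : α → α} {m : ℕ} {a : List α}
    (b : List α) (h : a.length ≤ m) :
    (a ++ b).modify m f = a ++ b.modify (m - a.length) f := by
  apply List.ext_getElem?
  intro i
  grind

namespace StringAtom

/-- Add `c` to the entry with index `m` of the tail of a string `i⌢a`, if `i = j` and this is
not the last entry, or if `i ≠ j` and this is the last entry. -/
def shiftList {n : ℕ} (j : Fin (n + 1)) (m : ℕ) (c : Fin (n + 1)) :
    List (Fin (n + 1)) → List (Fin (n + 1))
  | [] => []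
  | i :: a => i ::
      if (if i = j then m + 1 < a.length else a.length = m + 1) then a.modify m (· + c) else a

theorem length_shiftList {n : ℕ} (j : Fin (n + 1)) (m : ℕ) (c : Fin (n + 1))
    (s : List (Fin (n + 1))) : (shiftList j m c s).length = s.length := by
  cases s with
  | nil => rfl
  | cons i a => simp only [shiftList]; split_ifs <;> simp

theorem shiftList_ne_nil {n : ℕ} (j : Fin (n + 1)) (m : ℕ) (c : Fin (n + 1))
    {s : List (Fin (n + 1))} (h : s ≠ []) : shiftList j m c s ≠ [] := by
  rw [← List.length_pos_iff] at h ⊢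
  rwa [length_shiftList]

/-- Whether the entry is changed depends only on the head and the length, and neither is altered, so
shifts by opposite amounts cancel. -/
theorem shiftList_shiftList {n : ℕ} (j : Fin (n + 1)) (m : ℕ) {c d : Fin (n + 1)}
    (h : c + d = 0) (s : List (Fin (n + 1))) : shiftList j m d (shiftList j m c s) = s := by
  cases s with
  | nil => rfl
  | cons i a =>
    have hm : (a.modify m (· + c)).modify m (· + d) = a := by
      rw [List.modify_modify_eq]
      convert List.modify_id m a
      ext1 x
      simp [add_assoc, h]
    by_cases hP : (if i = j then m + 1 < a.length else a.length = m + 1)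
    · simp only [shiftList, if_pos hP, List.length_modify, hm]
    · simp only [shiftList, if_neg hP]

/-- The permutation of the atoms given by `shiftList` on each level. -/
def shift (j : ∀ n, Fin (n + 1)) (m : ℕ) (c : ∀ n, Fin (n + 1)) : Equiv.Perm StringAtom where
  toFun a := ⟨a.1, shiftList (j a.1) m (c a.1) a.2.1, shiftList_ne_nil _ _ _ a.2.2⟩
  invFun a := ⟨a.1, shiftList (j a.1) m (-c a.1) a.2.1, shiftList_ne_nil _ _ _ a.2.2⟩
  left_inv := fun ⟨n, s, hs⟩ => by
    simp only [shiftList_shiftList _ _ (add_neg_cancel _)]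
  right_inv := fun ⟨n, s, hs⟩ => by
    simp only [shiftList_shiftList _ _ (neg_add_cancel _)]

theorem shift_neg_shift (j : ∀ n, Fin (n + 1)) (m : ℕ) (c : ∀ n, Fin (n + 1))
    (a : StringAtom) : shift j m (-c) (shift j m c a) = a :=
  (shift j m c).symm_apply_apply a

theorem shift_shift_neg (j : ∀ n, Fin (n + 1)) (m : ℕ) (c : ∀ n, Fin (n + 1))
    (a : StringAtom) : shift j m c (shift j m (-c) a) = a :=
  (shift j m c).apply_symm_apply a

theorem shift_cons (j : ∀ n, Fin (n + 1)) (m : ℕ) (c : ∀ n, Fin (n + 1)) {n : ℕ}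
    (i : Fin (n + 1)) (a : List (Fin (n + 1))) :
    shift j m c (cons n i a) = cons n i
      (if (if i = j n then m + 1 < a.length else a.length = m + 1)
        then a.modify m (· + c n) else a) := rfl

theorem shift_cons_of_ne (j : ∀ n, Fin (n + 1)) (m : ℕ) (c : ∀ n, Fin (n + 1)) {n : ℕ}
    {i : Fin (n + 1)} {a : List (Fin (n + 1))} (h : i ≠ j n) :
    shift j m c (cons n i a) = cons n i
      (if a.length = m + 1 then a.modify m (· + c n) else a) := by
  simp only [shift_cons, if_neg h]

/-- `shift` fixes the strings that are not longer than the index of the entry. -/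
theorem shift_cons_of_length_le (j : ∀ n, Fin (n + 1)) {m : ℕ} (c : ∀ n, Fin (n + 1)) {n : ℕ}
    (i : Fin (n + 1)) {a : List (Fin (n + 1))} (h : a.length ≤ m) :
    shift j m c (cons n i a) = cons n i a := by
  rw [shift_cons, List.modify_eq_self h, ite_self]

theorem exists_eq_cons {n : ℕ} {a : StringAtom} (ha : a ∈ level n) :
    ∃ i s, a = cons n i s := by
  rw [level_eq, Set.mem_iUnion] at ha
  exact ha

theorem cons_inj {n : ℕ} {i i' : Fin (n + 1)} {s s' : List (Fin (n + 1))} :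
    cons n i s = cons n i' s' ↔ i = i' ∧ s = s' := by
  simp [cons]

theorem shift_mem_cell (j : ∀ n, Fin (n + 1)) (m : ℕ) (c : ∀ n, Fin (n + 1)) {n : ℕ}
    {i : Fin (n + 1)} {a : StringAtom} (ha : a ∈ cell n i) : shift j m c a ∈ cell n i := by
  obtain ⟨s, rfl⟩ := ha
  exact ⟨_, shift_cons j m c i s⟩

theorem IsShort.map_shift {n : ℕ} {x : Fin (n + 1) → StringAtom} {e : Fin (n + 1) → Fin (n + 1)}
    (hx : IsShort x e) (j : ∀ n, Fin (n + 1)) (m : ℕ) (c : ∀ n, Fin (n + 1)) :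
    ∃ e', IsShort (fun i => shift j m c (x i)) e' := by
  have h : ∀ i, ∃ e', shift j m c (x i) = cons n i [e'] := fun i => by
    rw [hx i, shift_cons]
    simp only [cons_inj, true_and, ← List.length_eq_one_iff]
    split_ifs <;> simp
  choose e' he' using h
  exact ⟨e', he'⟩

/-- This is the compatibility of shifts with f_n on long tuples. With p the common length of the
s_i, index p carries k_i in the argument and the last entry in the value. For m < p, the same entry
of s_j changes on both sides. -/
theorem IsLong.map_shift {n : ℕ} {x : Fin (n + 1) → StringAtom}
    {s : Fin (n + 1) → List (Fin (n + 1))} {k l : Fin (n + 1) → Fin (n + 1)}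
    (hx : IsLong x s k l) (j : ∀ n, Fin (n + 1)) (m : ℕ) (c : ∀ n, Fin (n + 1)) :
    ∃ s' k' l', IsLong (fun i => shift j m c (x i)) s' k' l' ∧
      ∀ i, shift j m c (cons n i (s i ++ [∑ t ∈ Finset.univ.erase i, k t])) =
        cons n i (s' i ++ [∑ t ∈ Finset.univ.erase i, k' t]) := by
  obtain ⟨p, hp⟩ : ∃ p, ∀ i, (s i).length = p := ⟨(s 0).length, fun i => hx.1 i 0⟩
  rcases lt_trichotomy m p with hmp | rfl | hpm
  · refine ⟨fun i => if i = j n then (s i).modify m (· + c n) else s i, k, l,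
      ⟨fun i i' => ?_, fun i => ?_⟩, fun i => ?_⟩
    · have : ∀ i, (if i = j n then (s i).modify m (· + c n) else s i).length = p := fun i => by
        split_ifs <;> simp [hp]
      rw [this, this]
    · change shift j m c (x i) = _
      rw [hx.2 i, shift_cons]
      by_cases hi : i = j n
      · simp only [if_pos hi, List.length_append, hp, List.length_cons, List.length_nil]
        rw [if_pos (by omega), List.modify_append_of_lt_length _ (by rw [hp]; exact hmp)]
      · simp only [if_neg hi, List.length_append, hp, List.length_cons, List.length_nil]
        rw [if_neg (by omega)]
    · rw [shift_cons]
      by_cases hi : i = j n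
      · simp only [if_pos hi, List.length_append, hp, List.length_cons, List.length_nil]
        rw [if_pos (by omega), List.modify_append_of_lt_length _ (by rw [hp]; exact hmp)]
      · simp only [if_neg hi, List.length_append, hp, List.length_cons, List.length_nil]
        rw [if_neg (by omega)]
  -- In the argument only k_j changes; in the value the last entries outside cell j change, exactly
  -- the sums that contain k_j.
  · refine ⟨s, k + Pi.single (j n) (c n), l, ⟨hx.1, fun i => ?_⟩, fun i => ?_⟩
    · change shift j m c (x i) = _
      rw [hx.2 i, shift_cons]
      by_cases hi : i = j n
      · subst hi
        simp only [if_true, List.length_append, hp, List.length_cons, List.length_nil]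
        rw [if_pos (by omega), List.modify_append_of_length_le _ (hp _).le]
        simp [hp]
      · simp only [if_neg hi, List.length_append, hp, List.length_cons, List.length_nil]
        rw [if_neg (by omega)]
        simp [Pi.single_eq_of_ne hi]
    · rw [shift_cons]
      by_cases hi : i = j n
      · subst hi
        simp only [if_true, List.length_append, hp, List.length_cons, List.length_nil]
        rw [if_neg (by omega)]
        simp [Finset.sum_add_distrib, Finset.sum_pi_single']
      · simp only [if_neg hi, List.length_append, hp, List.length_cons, List.length_nil]
        rw [if_pos (by trivial), List.modify_append_of_length_le _ (hp _).le]
        simp [hp, Finset.sum_add_distrib, Finset.sum_pi_single', Ne.symm hi]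
  -- Only the l_i can change, when m = p + 1, and f_n discards them; the value is too short to be
  -- affected.
  · refine ⟨s, k, fun i => if i ≠ j n ∧ m = p + 1 then l i + c n else l i,
      ⟨hx.1, fun i => ?_⟩, fun i => ?_⟩
    · change shift j m c (x i) = _
      rw [hx.2 i, shift_cons]
      by_cases hi : i = j n
      · simp only [if_pos hi, List.length_append, hp, List.length_cons, List.length_nil]
        rw [if_neg (by omega)]
        simp [hi]
      · simp only [if_neg hi, List.length_append, hp, List.length_cons, List.length_nil]
        by_cases hm : m = p + 1
        · subst hm
          rw [if_pos (by omega), List.modify_append_of_length_le _ (by rw [hp]; omega)]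
          simp [hp, hi]
        · rw [if_neg (by omega)]
          simp [hm]
    · rw [shift_cons]
      by_cases hi : i = j n
      · simp only [if_pos hi, List.length_append, hp, List.length_cons, List.length_nil]
        rw [if_neg (by omega)]
      · simp only [if_neg hi, List.length_append, hp, List.length_cons, List.length_nil]
        rw [if_neg (by omega)]

theorem FGraph.map_shift {n : ℕ} {x : Fin (n + 1) → StringAtom}
    {y : Option (Fin (n + 1) → StringAtom)} (h : FGraph n x y) (j : ∀ n, Fin (n + 1)) (m : ℕ)
    (c : ∀ n, Fin (n + 1)) : FGraph n (fun i => shift j m c (x i))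
      (y.map fun z i => shift j m c (z i)) := by
  cases h with
  | short e hx =>
    obtain ⟨e', he'⟩ := hx.map_shift j m c
    exact .short _ e' he'
  | long s k l hx =>
    obtain ⟨s', k', l', h', hy⟩ := hx.map_shift j m c
    rw [Option.map_some, funext hy]
    exact .long _ s' k' l' h'
  | other hx hshort hlong =>
    -- If the shifted tuple were short or long, the inverse shift would make the original one so.
    refine .other _ (fun i => shift_mem_cell j m c (hx i)) (fun e he => ?_)
      fun s k l h => ?_
    · obtain ⟨e', he'⟩ := he.map_shift j m (-c)
      simp only [shift_neg_shift] at he'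
      exact hshort e' he'
    · obtain ⟨s', k', l', h', -⟩ := h.map_shift j m (-c)
      simp only [shift_neg_shift] at h'
      exact hlong s' k' l' h'

theorem shift_mem_group (j : ∀ n, Fin (n + 1)) (m : ℕ) (c : ∀ n, Fin (n + 1)) :
    shift j m c ∈ group := by
  refine ⟨fun n i => ?_, fun n s t h => ?_, fun n x y => ⟨fun h => h.map_shift j m c, fun h => ?_⟩⟩
  · refine Set.Subset.antisymm ?_ fun a ha => ?_
    · rintro _ ⟨a, ha, rfl⟩
      exact shift_mem_cell j m c ha
    · exact ⟨_, shift_mem_cell j m (-c) ha, shift_shift_neg j m c a⟩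
  · have := congrArg (fun a : StringAtom => a.2.1.length) h
    exact (length_shiftList _ _ _ _).symm.trans this
  · have := h.map_shift j m (-c)
    simpa only [shift_neg_shift, Option.map_map, Function.comp_def, Option.map_id'] using this

open Filter

/-! ### Stabilizers of `n`-tuples -/

/-- There is no infinite sequence of distinct `n`-tuples with decreasing stabilizers. -/
theorem not_antitone_stabilizer {n : ℕ} {E : Set StringAtom} (hE : E.Finite)
    (x : ℕ → Fin n → level n) (hx : Function.Injective x) :
    ¬ Antitone fun k => {π : Equiv.Perm StringAtom |
      π ∈ group ∧ (∀ a ∈ E, π a = a) ∧ ∀ i, π (x k i).1 = (x k i).1} := by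
  intro hanti
  choose c t hct using fun a : level n => exists_eq_cons a.2
  have hfin : ∀ B, {a : level n | (t a).length < B}.Finite := fun B => by
    have : Function.Injective fun a => (c a, t a) := fun a b hab => by
      obtain ⟨h1, h2⟩ := Prod.mk.inj hab
      exact Subtype.ext (by rw [hct a, hct b, h1, h2])
    refine ((Set.finite_univ.prod (List.finite_length_lt _ B)).preimage this.injOn).subset ?_
    exact fun a ha => ⟨trivial, ha⟩
  obtain ⟨BE, hBE⟩ := (hE.image fun a => a.2.1.length).bddAbove
  -- A non-principal ultrafilter on the indices replaces passing to subsequences: each coordinate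
  -- has a fixed cell `i p` on a large set.
  choose i hi using fun p => Ultrafilter.eq_pure_of_finite
    ((hyperfilter ℕ).map fun k => c (x k p))
  have hcell : ∀ᶠ k in hyperfilter ℕ, ∀ p, c (x k p) = i p := by
    refine eventually_all.2 fun p => ?_
    have : {i p} ∈ (hyperfilter ℕ).map fun k => c (x k p) := by
      rw [hi p]
      exact rfl
    exact this
  -- Along the ultrafilter, each length either tends to infinity or is bounded on a large set; B = 0
  -- is a dummy in the first case.
  have hbound : ∀ p, ∃ B, Tendsto (fun k => (t (x k p)).length) (hyperfilter ℕ) atTop ∨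
      ∀ᶠ k in hyperfilter ℕ, (t (x k p)).length < B := fun p => by
    by_cases h : Tendsto (fun k => (t (x k p)).length) (hyperfilter ℕ) atTop
    · exact ⟨0, Or.inl h⟩
    · simp only [tendsto_atTop, not_forall] at h
      obtain ⟨B, hB⟩ := h
      refine ⟨B, Or.inr ?_⟩
      simpa only [not_le] using Ultrafilter.eventually_not.2 hB
  choose b hb using hbound
  obtain ⟨B, hB⟩ := (Set.finite_range b).bddAbove
  have hbB : ∀ p, b p ≤ B := fun p => hB ⟨p, rfl⟩
  -- If all lengths were bounded, a large, hence infinite, set of indices would give distinct tuples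
  -- from a finite set.
  obtain ⟨p, hp⟩ : ∃ p, Tendsto (fun k => (t (x k p)).length) (hyperfilter ℕ) atTop := by
    by_contra! hno
    have hev : ∀ᶠ k in hyperfilter ℕ, ∀ p, (t (x k p)).length < B :=
      eventually_all.2 fun p => ((hb p).resolve_left (hno p)).mono fun k hk => hk.trans_le (hbB p)
    have hf : {k | ∀ p, (t (x k p)).length < B}.Finite :=
      ((Set.Finite.pi fun _ => hfin B).preimage hx.injOn).subset fun k hk p _ => hk p
    exact hf.notMem_hyperfilter hev
  -- The tail of x_k(p) gets length m + 1 with m ≥ B and m ≥ BE, beyond the bounded coordinates and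
  -- all of E.
  obtain ⟨k, hkc, hkp⟩ := (hcell.and (hp.eventually_ge_atTop (max B BE + 1))).exists
  obtain ⟨m, hm⟩ : ∃ m, (t (x k p)).length = m + 1 := ⟨_, (Nat.sub_add_cancel (by omega)).symm⟩
  -- Length m + 1 is eventually avoided: unbounded coordinates exceed it, bounded ones stay below B
  -- ≤ m.
  have hlen : ∀ᶠ k' in hyperfilter ℕ, ∀ q, (t (x k' q)).length ≠ m + 1 := by
    refine eventually_all.2 fun q => ?_
    rcases hb q with h | h
    · exact (h.eventually_gt_atTop (m + 1)).mono fun k' hk' => hk'.ne'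
    · exact h.mono fun k' hk' => by have := hbB q; omega
  obtain ⟨k', ⟨hk'c, hk'l⟩, hkk'⟩ := ((hcell.and hlen).and
    ((eventually_ge_atTop k).filter_mono Nat.hyperfilter_le_atTop)).exists
  -- The n coordinates cannot occupy all n + 1 cells.
  obtain ⟨j, hj⟩ : ∃ j, ∀ q, i q ≠ j := by
    by_contra! h
    simpa using Fintype.card_le_of_surjective i h
  -- The choice at the other levels is irrelevant: atoms of E are fixed because their strings are
  -- short.
  let J : ∀ n, Fin (n + 1) := Function.update (fun _ => 0) n j
  have hJ : J n = j := Function.update_self ..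
  have hE' : ∀ a ∈ E, shift J m 1 a = a := fun a ha => by
    have ha' : a.2.1.length ≤ BE := hBE ⟨a, ha, rfl⟩
    obtain ⟨e, s, hs⟩ := exists_eq_cons (a := a) ⟨a.2, rfl⟩
    rw [hs] at ha' ⊢
    refine shift_cons_of_length_le _ _ _ ?_
    simp only [cons, List.length_cons] at ha'
    omega
  have hk' : ∀ q, shift J m 1 (x k' q).1 = (x k' q).1 := fun q => by
    rw [hct (x k' q), shift_cons_of_ne _ _ _ (by rw [hk'c, hJ]; exact hj q), if_neg (hk'l q)]
  have h1 := (hanti hkk' ⟨shift_mem_group _ _ _, hE', hk'⟩).2.2 p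
  rw [hct (x k p), shift_cons_of_ne _ _ _ (by rw [hkc, hJ]; exact hj p), if_pos hm,
    cons_inj] at h1
  have h2 := congrArg (fun l => l[m]?) h1.2
  -- The coordinate p shows n > 0, so 1 ≠ 0 modulo n + 1 and the shift really moves x_k(p).
  obtain ⟨n, rfl⟩ := Nat.exists_eq_succ_of_ne_zero (p.pos : 0 < n).ne'
  simp [hm] at h2

/-! ### The maps `f_n` -/

theorem FGraph.mem_cell {n : ℕ} {x : Fin (n + 1) → StringAtom}
    {y : Option (Fin (n + 1) → StringAtom)} (h : FGraph n x y) (i : Fin (n + 1)) :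
    x i ∈ cell n i := by
  cases h with
  | short j hx => exact ⟨_, hx i⟩
  | long s k l hx => exact ⟨_, hx.2 i⟩
  | other hx => exact hx i

theorem FGraph.mem_cell_of_some {n : ℕ} {x y : Fin (n + 1) → StringAtom}
    (h : FGraph n x (some y)) (i : Fin (n + 1)) : y i ∈ cell n i := by
  cases h with
  | long s k l hx => exact ⟨_, rfl⟩
  | other hx => exact hx i

theorem IsShort.not_isLong {n : ℕ} {x : Fin (n + 1) → StringAtom}
    {j : Fin (n + 1) → Fin (n + 1)} (hx : IsShort x j) {s : Fin (n + 1) → List (Fin (n + 1))}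
    {k l : Fin (n + 1) → Fin (n + 1)} : ¬ IsLong x s k l := fun h => by
  have := congrArg List.length (cons_inj.1 ((hx 0).symm.trans (h.2 0))).2
  simp at this

theorem FGraph.unique {n : ℕ} {x : Fin (n + 1) → StringAtom}
    {y y' : Option (Fin (n + 1) → StringAtom)} (h : FGraph n x y) (h' : FGraph n x y') :
    y = y' := by
  cases h with
  | short j hx =>
    cases h' with
    | short j' hx' => rfl
    | long s k l hx' => exact absurd hx' hx.not_isLong
    | other _ hs _ => exact absurd hx (hs j)
  | long s k l hx =>
    cases h' with
    | short j' hx' => exact absurd hx hx'.not_isLong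
    | long s' k' l' hx' =>
      have key : ∀ i, s i = s' i ∧ k i = k' i := fun i => by
        have := (cons_inj.1 ((hx.2 i).symm.trans (hx'.2 i))).2
        obtain ⟨h1, h2⟩ := List.append_inj' this rfl
        exact ⟨h1, (List.cons.inj h2).1⟩
      obtain rfl : s = s' := funext fun i => (key i).1
      obtain rfl : k = k' := funext fun i => (key i).2
      rfl
    | other _ _ hl => exact absurd hx (hl s k l)
  | other _ hs hl =>
    cases h' with
    | short j hx' => exact absurd hx' (hs j)
    | long s k l hx' => exact absurd hx' (hl s k l)
    | other => rfl

theorem FGraph.exists {n : ℕ} {x : Fin (n + 1) → StringAtom} (hx : ∀ i, x i ∈ cell n i) :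
    ∃ y, FGraph n x y := by
  by_cases hs : ∃ j, IsShort x j
  · obtain ⟨j, hj⟩ := hs
    exact ⟨_, .short x j hj⟩
  by_cases hl : ∃ s k l, IsLong x s k l
  · obtain ⟨s, k, l, h⟩ := hl
    exact ⟨_, .long x s k l h⟩
  · push Not at hs hl
    exact ⟨_, .other x hx hs hl⟩

/-- Modulo `n + 1`, every sequence `m_0, …, m_n` has the form `m_i = ∑ j ≠ i, k_j`. -/
theorem exists_sum_erase_eq {n : ℕ} (m : Fin (n + 1) → Fin (n + 1)) :
    ∃ k : Fin (n + 1) → Fin (n + 1), ∀ i, ∑ j ∈ Finset.univ.erase i, k j = m i := by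
  -- The inverse of J − I is −J − I, as J² = (n + 1)J = 0.
  refine ⟨fun i => -(∑ j, m j) - m i, fun i => ?_⟩
  have h : (n + 1) • (∑ j, m j) = 0 := by
    simpa using card_nsmul_eq_zero (x := ∑ j, m j)
  rw [Finset.sum_erase_eq_sub (Finset.mem_univ i), Finset.sum_sub_distrib, Finset.sum_const,
    Finset.card_univ, Fintype.card_fin, smul_neg, h]
  abel

/-- If all tails have the same nonzero length, the last entries are solved for k and the l_i are
arbitrary. Otherwise the tuple is neither short nor long, and f_n fixes it. -/
theorem FGraph.exists_some {n : ℕ} {y : Fin (n + 1) → StringAtom} (hy : ∀ i, y i ∈ cell n i) :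
    ∃ x, FGraph n x (some y) := by
  choose s hs using hy
  by_cases hp : ∃ p, ∀ i, (s i).length = p + 1
  · obtain ⟨p, hp⟩ := hp
    have hex : ∀ i, ∃ t m, s i = t ++ [m] := fun i =>
      ⟨_, _, (List.dropLast_append_getLast (List.ne_nil_of_length_eq_add_one (hp i))).symm⟩
    choose t m htm using hex
    obtain ⟨k, hk⟩ := exists_sum_erase_eq m
    have hlen : ∀ i, (t i).length = p := fun i => by
      have := hp i
      rw [htm i] at this
      simpa using this
    refine ⟨fun i => cons n i (t i ++ [k i, 0]), ?_⟩
    have hy : y = fun i => cons n i (t i ++ [∑ j ∈ Finset.univ.erase i, k j]) :=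
      funext fun i => by rw [hs, htm, hk]
    rw [hy]
    exact .long _ t k (fun _ => 0) ⟨fun i i' => (hlen i).trans (hlen i').symm, fun i => rfl⟩
  · refine ⟨y, .other y (fun i => ⟨_, hs i⟩) (fun j hj => hp ⟨0, fun i => ?_⟩)
      fun t k l h => hp ⟨(t 0).length + 1, fun i => ?_⟩⟩
    · rw [(cons_inj.1 ((hs i).symm.trans (hj i))).2]
      rfl
    · rw [(cons_inj.1 ((hs i).symm.trans (h.2 i))).2, List.length_append, h.1 i 0]
      rfl

/-! ### A surjection of `A_n ^ (n + 1)` onto itself that is not injective -/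

/-- `y` is the value at `x` of the map that extends `f_n` to all tuples by the identity and has
the value `([0]_n, …, [n]_n)` where `f_n` has the value `∅`. -/
def Step (n : ℕ) (x y : Fin (n + 1) → StringAtom) : Prop :=
  FGraph n x (some y) ∨ (FGraph n x none ∧ y = fun i => cons n i []) ∨
    (¬ (∀ i, x i ∈ cell n i) ∧ y = x)

theorem Step.unique {n : ℕ} {x y y' : Fin (n + 1) → StringAtom} (h : Step n x y)
    (h' : Step n x y') : y = y' := by
  rcases h with h | ⟨h, rfl⟩ | ⟨h, rfl⟩ <;> rcases h' with h' | ⟨h', rfl⟩ | ⟨h', rfl⟩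
  · exact Option.some.inj (h.unique h')
  · cases h.unique h'
  · exact absurd h.mem_cell h'
  · cases h.unique h'
  · rfl
  · exact absurd h.mem_cell h'
  · exact absurd h'.mem_cell h
  · exact absurd h'.mem_cell h
  · rfl

theorem cons_mem_level {n : ℕ} (i : Fin (n + 1)) (s : List (Fin (n + 1))) :
    cons n i s ∈ level n := ⟨_, rfl⟩

theorem mem_level_of_mem_cell {n : ℕ} {i : Fin (n + 1)} {a : StringAtom} (h : a ∈ cell n i) :
    a ∈ level n := by
  obtain ⟨s, rfl⟩ := h
  exact cons_mem_level i s

theorem Step.exists {n : ℕ} (x : Fin (n + 1) → level n) :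
    ∃ y : Fin (n + 1) → level n, Step n (fun i => (x i).1) fun i => (y i).1 := by
  by_cases hx : ∀ i, (x i).1 ∈ cell n i
  · obtain ⟨y, hy⟩ := FGraph.exists hx
    cases y with
    | none => exact ⟨fun i => ⟨_, cons_mem_level i []⟩, Or.inr (Or.inl ⟨hy, rfl⟩)⟩
    | some y => exact ⟨fun i => ⟨y i, mem_level_of_mem_cell (hy.mem_cell_of_some i)⟩, Or.inl hy⟩
  · exact ⟨x, Or.inr (Or.inr ⟨hx, rfl⟩)⟩

theorem Step.exists_left {n : ℕ} (y : Fin (n + 1) → level n) :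
    ∃ x : Fin (n + 1) → level n, Step n (fun i => (x i).1) fun i => (y i).1 := by
  by_cases hy : ∀ i, (y i).1 ∈ cell n i
  · obtain ⟨x, hx⟩ := FGraph.exists_some hy
    exact ⟨fun i => ⟨x i, mem_level_of_mem_cell (hx.mem_cell i)⟩, Or.inl hx⟩
  · exact ⟨y, Or.inr (Or.inr ⟨hy, rfl⟩)⟩

theorem IsAdmissible.apply_mem_cell {π : Equiv.Perm StringAtom} (hπ : IsAdmissible π) {n : ℕ}
    {i : Fin (n + 1)} {a : StringAtom} : π a ∈ cell n i ↔ a ∈ cell n i := by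
  conv_lhs => rw [← hπ.1 n i]
  exact π.injective.mem_set_image

/-- The string i is the only one of length 1 in its cell. This makes the value substituted for ∅
invariant. -/
theorem IsAdmissible.apply_cons_nil {π : Equiv.Perm StringAtom} (hπ : IsAdmissible π) {n : ℕ}
    (i : Fin (n + 1)) : π (cons n i []) = cons n i [] := by
  obtain ⟨s, hs⟩ := hπ.apply_mem_cell.2 (⟨[], rfl⟩ : cons n i [] ∈ cell n i)
  have := hπ.2.1 n _ _ hs
  simp only [List.length_cons, List.length_nil] at this
  rw [hs, List.length_eq_zero_iff.1 (show s.length = 0 by omega)]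

theorem Step.map {n : ℕ} {x y : Fin (n + 1) → StringAtom} (h : Step n x y)
    {π : Equiv.Perm StringAtom} (hπ : IsAdmissible π) :
    Step n (fun i => π (x i)) fun i => π (y i) := by
  rcases h with h | ⟨h, rfl⟩ | ⟨h, rfl⟩
  · exact Or.inl ((hπ.2.2 n x _).1 h)
  · exact Or.inr (Or.inl ⟨(hπ.2.2 n x _).1 h, funext fun i => hπ.apply_cons_nil i⟩)
  · exact Or.inr (Or.inr ⟨by simpa only [hπ.apply_mem_cell] using h, rfl⟩)

theorem step_cons_nil (n : ℕ) : Step n (fun i => cons n i []) fun i => cons n i [] := by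
  refine Or.inl (.other _ (fun i => ⟨_, rfl⟩) (fun j hj => ?_) fun s k l h => ?_)
  · simpa using (cons_inj.1 (hj 0)).2
  · simpa using (cons_inj.1 (h.2 0)).2

theorem step_cons_singleton (n : ℕ) : Step n (fun i => cons n i [0]) fun i => cons n i [] :=
  Or.inr (Or.inl ⟨.short _ 0 fun _ => rfl, rfl⟩)

theorem image_level_of_mem_group (n : ℕ) : ∀ π ∈ group, π '' level n = level n :=
  fun _ hπ => IsAdmissible.image_level hπ n

theorem duallyDedekindFinite_power_level (n : ℕ) : SetAtomStructure.DuallyDedekindFinite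
    (PermModel.power.{u} (image_level_of_mem_group n) n) :=
  PermModel.duallyDedekindFinite_power _ fun E hE _ hsurj hh =>
    hsurj.injective_of_no_monotone_seq
      (fun x => {π : Equiv.Perm StringAtom |
        π ∈ group ∧ (∀ a ∈ E, π a = a) ∧ ∀ i, π (x i).1 = (x i).1})
      (fun x π hπ => ⟨hπ.1, hπ.2.1, hh π hπ.1 hπ.2.1 x hπ.2.2⟩)
      fun x hx => not_antitone_stabilizer hE x hx

theorem duallyDedekindInfinite_power_level (n : ℕ) : SetAtomStructure.DuallyDedekindInfinite
    (PermModel.power.{u} (image_level_of_mem_group n) (n + 1)) := by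
  choose F hF using fun x : Fin (n + 1) → level n => Step.exists x
  -- `Step` is single-valued, so F does not depend on the choice and inherits the equivariance of
  -- `Step`.
  have huniq : ∀ {x y : Fin (n + 1) → level n},
      Step n (fun i => (x i).1) (fun i => (y i).1) → F x = y := fun {x y} h =>
    funext fun i => Subtype.ext (congrFun ((hF x).unique h) i)
  refine PermModel.duallyDedekindInfinite_power _ F (fun π hπ x => huniq ((hF x).map hπ))
    (fun y => ?_) fun hinj => ?_
  · obtain ⟨x, hx⟩ := Step.exists_left y
    exact ⟨x, huniq hx⟩
  · let x : Fin (n + 1) → level n := fun i => ⟨_, cons_mem_level i []⟩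
    let y : Fin (n + 1) → level n := fun i => ⟨_, cons_mem_level i [0]⟩
    have hxy : F x = F y := (huniq (y := x) (step_cons_nil n)).trans
      (huniq (x := y) (y := x) (step_cons_singleton n)).symm
    have h0 := congrArg Subtype.val (congrFun (hinj hxy) 0)
    simpa using (cons_inj.1 h0).2

end StringAtom

theorem mainTheorem2 (n : ℕ) :
    (∃ X : StringModel.{u}, SetAtomStructure.IsPower X (StringModel.A n) n ∧
      SetAtomStructure.DuallyDedekindFinite X) ∧
    (∃ Y : StringModel.{u}, SetAtomStructure.IsPower Y (StringModel.A n) (n + 1) ∧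
      SetAtomStructure.DuallyDedekindInfinite Y) := by
  exact ⟨⟨_, PermModel.isPower_power _ n rfl, StringAtom.duallyDedekindFinite_power_level n⟩,
    ⟨_, PermModel.isPower_power _ (n + 1) rfl, StringAtom.duallyDedekindInfinite_power_level n⟩⟩
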